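/- **Proposition (conditional expectation on $L^\infty(A;Y)$).** Let $\mathbb K\in\{\mathbb R,\mathbb C\}$, let $(A,\mathscr A,\mu)$ be a semi-finite measure space and $\mathscr F\subset\mathscr A$ a sub-$\sigma$-algebra such that $(A,\mathscr F,\mu|_{\mathscr F})$ is Maharam. Here *semi-finite* means that every measurable set of positive measure contains a measurable set of positive finite measure, and *Maharam* (localizable) means semi-finite and such that for every family $\mathscr E$ of measurable sets there is a measurable $H$ with $E\setminus H$ negligible for all $E\in\mathscr E$, and with $H\setminus G$ negligible whenever $G$ is measurable and $E\setminus G$ is negligible for all $E\in\mathscr E$. For a Banach space $Z$ over $\mathbb K$ and $p\in\{1,\infty\}$ let $L^p(A,\mathscr F;Z)$ be the subspace of $L^p(A;Z)$ of all classes having a strongly $\mathscr F$-measurable representative. Let $Y$ be any Banach space over $\mathbb K$. Then the conditional expectation operator $\mathbb E^\infty_{\mathscr F,Y}$ on $L^\infty(A;Y)$ exists: for every $g\in L^\infty(A;Y)$ there is a unique $\mathbb E^\infty_{\mathscr F,Y}g\in L^\infty(A,\mathscr F;Y)$ with $$\int_F g\,d\mu=\int_F \mathbb E^\infty_{\mathscr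 F,Y}g\,d\mu\qquad\text{for all }F\in\mathscr F\text{ with }\mu(F)<\infty,$$ and $\mathbb E^\infty_{\mathscr F,Y}$ is a bounded linear operator. It is a contractive projection ($\|\mathbb E^\infty_{\mathscr F,Y}\|\le 1$) on $L^\infty(A;Y)$ with range $L^\infty(A,\mathscr F;Y)$. Moreover, it is dual to the conditional expectation on $L^1(A;X)$ for every Banach dual pair $\langle X,Y\rangle$, i.e. for every Banach space $X$ over $\mathbb K$ with a bounded bilinear form $\langle\cdot,\cdot\rangle:X\times Y\to\mathbb K$ whose induced maps $X\to Y^*$ and $Y\to X^*$ are injective. Precisely, for a Banach space $Z$ say that $f'$ is a conditional expectation of $f\in L^1(A;Z)$ if $f'\in L^1(A,\mathscr F;Z)$ and $\int_F f\,d\mu=\int_F f'\,d\mu$ for all $F\in\mathscr F$. Then: 1. If $f'$ is a conditional expectation of $f\in L^1(A;X)$, then $\int\langle f,\mathbb E^\infty_{\mathscr F,Y}g\rangle\,d\mu=\int\langle f',g\rangle\,d\mu$ for all $g\in L^\infty(A;Y)$. 2. Every $f\in L^1(A;X)$ that vanishes a.e. outside a countable union of sets of finite measure in $\mathscr F$ has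 a conditional expectation. 3. If the scalar conditional expectation operator $\mathbb E^1_{\mathscr F}$ on $L^1(A)$ exists (every $f\in L^1(A)$ has a conditional expectation; by 2 this is automatic if $\mu|_{\mathscr F}$ is $\sigma$-finite), then every $f\in L^1(A;X)$ has a unique conditional expectation $\mathbb E^1_{\mathscr F,X}f$, the operator $\mathbb E^1_{\mathscr F,X}$ on $L^1(A;X)$ is linear and bounded, and $$\int\langle f,\mathbb E^\infty_{\mathscr F,Y}g\rangle\,d\mu=\int\langle \mathbb E^1_{\mathscr F,X}f,g\rangle\,d\mu,\qquad f\in L^1(A;X),\ g\in L^\infty(A;Y).$$ -/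

import Mathlib

open MeasureTheory
open scoped ENNReal

/-- A measure space is semi-finite if every measurable set of positive measure has a measurable
subset of positive finite measure. -/
def IsSemifiniteMeasure {A : Type*} {m : MeasurableSpace A} (μ : Measure A) : Prop :=
  ∀ B : Set A, MeasurableSet B → 0 < μ B →
    ∃ C : Set A, C ⊆ B ∧ MeasurableSet C ∧ 0 < μ C ∧ μ C < ∞

/-- A measure space is Maharam (localizable) if it is semi-finite and every family of measurable
sets has an essential supremum among the measurable sets. -/
def IsMaharamMeasure {A : Type*} {m : MeasurableSpace A} (μ : Measure A) : Prop :=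
  IsSemifiniteMeasure μ ∧
    ∀ 𝓔 : Set (Set A), (∀ E ∈ 𝓔, MeasurableSet E) →
      ∃ H : Set A, MeasurableSet H ∧ (∀ E ∈ 𝓔, μ (E \ H) = 0) ∧
        ∀ G : Set A, MeasurableSet G → (∀ E ∈ 𝓔, μ (E \ G) = 0) → μ (H \ G) = 0

/-- A bounded bilinear form on `X × Y` is a Banach duality if both induced maps `X → Y*` and
`Y → X*` are injective. -/
def IsBanachDuality {𝕜 X Y : Type*} [RCLike 𝕜] [NormedAddCommGroup X] [NormedSpace 𝕜 X]
    [NormedAddCommGroup Y] [NormedSpace 𝕜 Y] (B : X →L[𝕜] Y →L[𝕜] 𝕜) : Prop :=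
  Function.Injective B ∧ Function.Injective B.flip

/-- `f'` is a conditional expectation of `f ∈ L¹(A;X)` with respect to the sub-σ-algebra `m`:
it lies in `L¹(A,m;X)`, that is, it has a strongly `m`-measurable representative, and it has the
same integral as `f` over each `m`-measurable set. -/
def IsCondExpL1 {A X : Type*} (m : MeasurableSpace A) {m0 : MeasurableSpace A} {μ : Measure A}
    [NormedAddCommGroup X] [NormedSpace ℝ X] (f f' : Lp X 1 μ) : Prop :=
  AEStronglyMeasurable[m] f' μ ∧
    ∀ F : Set A, MeasurableSet[m] F → ∫ a in F, f a ∂μ = ∫ a in F, f' a ∂μ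

/-- `g'` is a conditional expectation of `g ∈ L^∞(A;Y)` with respect to the sub-σ-algebra `m`:
it lies in `L^∞(A,m;Y)`, that is, it has a strongly `m`-measurable representative, and it has the
same integral as `g` over each `m`-measurable set of finite measure. -/
def IsCondExpLinfty {A Y : Type*} (m : MeasurableSpace A) {m0 : MeasurableSpace A}
    {μ : Measure A} [NormedAddCommGroup Y] [NormedSpace ℝ Y] (g g' : Lp Y ∞ μ) : Prop :=
  AEStronglyMeasurable[m] g' μ ∧
    ∀ F : Set A, MeasurableSet[m] F → μ F < ∞ → ∫ a in F, g a ∂μ = ∫ a in F, g' a ∂μ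

/-! On each `F` in `m` of finite measure the classical conditional expectation of a bounded `g`
exists. These local versions agree on overlaps, but there may be uncountably many `F`;
localizability supplies the essential suprema that glue them (`IsMaharamMeasure.exists_glue_real`).
Semi-finiteness of the trimmed measure gives uniqueness and the global norm bound, since an
exceptional set in `m` that is null on every `F` is null.

On `L¹` the problem is σ-finiteness instead: a scalar conditional expectation of `‖f‖` confines `f`
to a σ-finite set of `m` (`IsCondExpL1.exists_sigmaFinite_support`), where the classical theory
applies. Duality is an orthogonality statement: both pairings equal `∫ ⟨f', E g⟩`
(`integral_pairing_condExp`). -/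

/-! ### Gluing on Maharam measure spaces -/

theorem IsSemifiniteMeasure.measure_eq_zero {α : Type*} {m : MeasurableSpace α} {ν : Measure α}
    (hν : IsSemifiniteMeasure ν) {S : Set α} (hS : MeasurableSet S)
    (h : ∀ F, MeasurableSet F → ν F < ∞ → ν (S ∩ F) = 0) : ν S = 0 := by
  by_contra hne
  obtain ⟨C, hCS, hC, hpos, hfin⟩ := hν S hS (pos_iff_ne_zero.2 hne)
  have := h C hC hfin
  rw [Set.inter_eq_right.2 hCS] at this
  exact hpos.ne' this

/-- A consistent family of real measurable functions on the sets of finite measure of a Maharam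
measure space can be glued. -/
theorem IsMaharamMeasure.exists_glue_real {α : Type*} {m : MeasurableSpace α} {ν : Measure α}
    (hν : IsMaharamMeasure ν) (f : Set α → α → ℝ)
    (hf : ∀ F, MeasurableSet F → ν F < ∞ → Measurable (f F))
    (hc : ∀ F G, MeasurableSet F → ν F < ∞ → MeasurableSet G → ν G < ∞ →
      ∀ᵐ x ∂ν, x ∈ F → x ∈ G → f F x = f G x) :
    ∃ φ : α → ℝ, Measurable φ ∧ ∀ F, MeasurableSet F → ν F < ∞ → ∀ᵐ x ∂ν, x ∈ F → f F x = φ x := by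
  -- Glue superlevel sets: `H` is the essential supremum of the local sets `F ∩ {q < f F}`.
  have key : ∀ q : ℚ, ∃ H : Set α, MeasurableSet H ∧ ∀ F, MeasurableSet F → ν F < ∞ →
      ∀ᵐ x ∂ν, x ∈ F → (x ∈ H ↔ (q : ℝ) < f F x) := by
    intro q
    obtain ⟨H, hH, hsup, hleast⟩ := hν.2
      {E | ∃ F, MeasurableSet F ∧ ν F < ∞ ∧ E = F ∩ {x | (q : ℝ) < f F x}} (by
        rintro _ ⟨F, hF, hF', rfl⟩
        exact hF.inter (measurableSet_lt measurable_const (hf F hF hF')))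
    refine ⟨H, hH, fun F hF hF' => ?_⟩
    have h1 := hsup _ ⟨F, hF, hF', rfl⟩
    -- By consistency this set is also an essential upper bound, so `H` adds nothing to the
    -- superlevel set inside `F`.
    have h2 := hleast (Fᶜ ∪ {x | (q : ℝ) < f F x})
      (hF.compl.union (measurableSet_lt measurable_const (hf F hF hF'))) (by
        rintro _ ⟨G, hG, hG', rfl⟩
        rw [measure_eq_zero_iff_ae_notMem]
        filter_upwards [hc F G hF hF' hG hG'] with x hx
        rintro ⟨⟨hxG, hxq⟩, hx2⟩
        simp only [Set.mem_union, Set.mem_compl_iff, Set.mem_ofPred_eq, not_or, not_not] at hx2 hxq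
        exact hx2.2 (by rw [hx hx2.1 hxG]; exact hxq))
    rw [measure_eq_zero_iff_ae_notMem] at h1 h2
    filter_upwards [h1, h2] with x h1 h2 hxF
    simp only [Set.mem_sdiff, Set.mem_inter_iff, Set.mem_union, Set.mem_compl_iff,
      Set.mem_ofPred_eq] at h1 h2
    tauto
  choose H hH hHF using key
  classical
  -- The sets `H q` are controlled only almost everywhere on each `F`, so the supremum may be
  -- infinite elsewhere.
  let φ : α → EReal := fun x => ⨆ q : ℚ, if x ∈ H q then ((q : ℝ) : EReal) else ⊥
  have hφ : Measurable φ :=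
    Measurable.iSup fun q => Measurable.ite (hH q) measurable_const measurable_const
  refine ⟨fun x => (φ x).toReal, hφ.ereal_toReal, fun F hF hF' => ?_⟩
  filter_upwards [ae_all_iff.2 fun q => hHF q F hF hF'] with x hx hxF
  have : φ x = (f F x : EReal) := by
    apply le_antisymm
    · refine iSup_le fun q => ?_
      split_ifs with h
      · exact EReal.coe_le_coe_iff.2 ((hx q hxF).1 h).le
      · exact bot_le
    · refine le_of_forall_lt fun c hc => ?_
      obtain ⟨q, hq1, hq2⟩ := EReal.lt_iff_exists_rat_btwn.1 hc
      have hxq : x ∈ H q := (hx q hxF).2 (EReal.coe_lt_coe_iff.1 hq2)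
      refine hq1.trans_le ?_
      have := le_iSup (fun q : ℚ => if x ∈ H q then ((q : ℝ) : EReal) else ⊥) q
      simpa only [if_pos hxq] using this
  rw [this, EReal.toReal_coe]

/-- A standard Borel space embeds measurably in `ℝ`; glue there and return by a measurable left
inverse. -/
theorem IsMaharamMeasure.exists_glue {α β : Type*} {m : MeasurableSpace α} {ν : Measure α}
    [MeasurableSpace β] [StandardBorelSpace β] [Nonempty β]
    (hν : IsMaharamMeasure ν) (f : Set α → α → β)
    (hf : ∀ F, MeasurableSet F → ν F < ∞ → Measurable (f F))
    (hc : ∀ F G, MeasurableSet F → ν F < ∞ → MeasurableSet G → ν G < ∞ →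
      ∀ᵐ x ∂ν, x ∈ F → x ∈ G → f F x = f G x) :
    ∃ φ : α → β, Measurable φ ∧ ∀ F, MeasurableSet F → ν F < ∞ → ∀ᵐ x ∂ν, x ∈ F → f F x = φ x := by
  obtain ⟨e, he⟩ := exists_measurableEmbedding_real β
  obtain ⟨φ, hφ, hφF⟩ := hν.exists_glue_real (fun F => e ∘ f F)
    (fun F hF hF' => he.measurable.comp (hf F hF hF'))
    (fun F G hF hF' hG hG' => (hc F G hF hF' hG hG').mono fun x hx h1 h2 => by simp [hx h1 h2])
  obtain ⟨r, hr, hre⟩ := he.exists_measurable_extend measurable_id fun _ => ‹Nonempty β›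
  refine ⟨r ∘ φ, hr.comp hφ, fun F hF hF' => (hφF F hF hF').mono fun x hx h1 => ?_⟩
  have := congrFun hre (f F x)
  simp only [Function.comp_apply, id] at this ⊢
  rw [← hx h1]
  exact this.symm

/-! ### Uniqueness, and existence for bounded functions -/

section Vector

variable {A Y : Type*} {m m0 : MeasurableSpace A} {μ : Measure A}
  [NormedAddCommGroup Y] [NormedSpace ℝ Y] [CompleteSpace Y]

theorem IsSemifiniteMeasure.ae_eq_of_forall_setIntegral_eq (hm : m ≤ m0)
    (hν : IsSemifiniteMeasure (μ.trim hm)) {f g : A → Y}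
    (hf : AEStronglyMeasurable[m] f μ) (hg : AEStronglyMeasurable[m] g μ)
    (hfi : ∀ F, MeasurableSet[m] F → μ F < ∞ → IntegrableOn f F μ)
    (hgi : ∀ F, MeasurableSet[m] F → μ F < ∞ → IntegrableOn g F μ)
    (h : ∀ F, MeasurableSet[m] F → μ F < ∞ → ∫ a in F, f a ∂μ = ∫ a in F, g a ∂μ) :
    f =ᵐ[μ] g := by
  have hF : ∀ F, MeasurableSet[m] F → μ F < ∞ → f =ᵐ[μ.restrict F] g := by
    intro F hF hF'
    have : IsFiniteMeasure (μ.restrict F) := ⟨by simpa using hF'⟩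
    refine ae_eq_of_forall_setIntegral_eq_of_sigmaFinite' hm (fun s _ _ => (hfi F hF hF').integrableOn)
      (fun s _ _ => (hgi F hF hF').integrableOn) (fun s hs _ => ?_)
      (hf.mono_measure Measure.restrict_le_self) (hg.mono_measure Measure.restrict_le_self)
    rw [Measure.restrict_restrict (hm _ hs)]
    exact h _ (hs.inter hF) ((measure_mono Set.inter_subset_right).trans_lt hF')
  -- The `m`-measurable representatives put the exceptional set in `m`, where semi-finiteness can be
  -- used.
  have hS : MeasurableSet[m] {x | hf.mk f x = hg.mk g x}ᶜ :=
    (StronglyMeasurable.measurableSet_eq_fun hf.stronglyMeasurable_mk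
      hg.stronglyMeasurable_mk).compl
  have h0 := hν.measure_eq_zero hS fun F hFm hFfin => by
    rw [trim_measurableSet_eq hm hFm] at hFfin
    rw [trim_measurableSet_eq hm (hS.inter hFm), measure_eq_zero_iff_ae_notMem]
    filter_upwards [(ae_restrict_iff' (hm _ hFm)).1 (hF F hFm hFfin), hf.ae_eq_mk, hg.ae_eq_mk]
      with x hx h1 h2
    rintro ⟨h3, h4⟩
    exact h3 (by simp only [Set.mem_ofPred_eq]; rw [← h1, ← h2, hx h4])
  rw [trim_measurableSet_eq hm hS] at h0
  have h1 : hf.mk f =ᵐ[μ] hg.mk g := h0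
  exact hf.ae_eq_mk.trans (h1.trans hg.ae_eq_mk.symm)

theorem condExp_restrict_ae_eq_of_subset (hm : m ≤ m0) {f : A → Y} {F G : Set A}
    (hG : MeasurableSet[m] G) (hF' : μ F < ∞) (hGF : G ⊆ F)
    (hf : IntegrableOn f F μ) :
    (μ.restrict G)[f | m] =ᵐ[μ.restrict G] (μ.restrict F)[f | m] := by
  have : IsFiniteMeasure (μ.restrict F) := ⟨by simpa using hF'⟩
  have h := condExp_restrict_ae_eq_restrict (μ := μ.restrict F) hm hG hf
  rwa [Measure.restrict_restrict (hm _ hG), Set.inter_eq_left.2 hGF] at h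

/-- A separable Banach space is Polish, so the conditional expectations for the finite measures
`μ.restrict F` can be glued. -/
theorem exists_bounded_condExp_of_secondCountable [SecondCountableTopology Y] (hm : m ≤ m0)
    (hν : IsMaharamMeasure (μ.trim hm)) {g : A → Y} (hg : AEStronglyMeasurable g μ) {C : ℝ}
    (hC : ∀ᵐ a ∂μ, ‖g a‖ ≤ C) :
    ∃ g' : A → Y, StronglyMeasurable[m] g' ∧ (∀ᵐ a ∂μ, ‖g' a‖ ≤ C) ∧
      ∀ F, MeasurableSet[m] F → μ F < ∞ → ∫ a in F, g a ∂μ = ∫ a in F, g' a ∂μ := by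
  borelize Y
  have hgi : ∀ F, MeasurableSet[m] F → μ F < ∞ → IntegrableOn g F μ := fun F hF hF' =>
    IntegrableOn.of_bound hF' hg.restrict C (ae_restrict_of_ae hC)
  obtain ⟨g', hg', hgF⟩ := hν.exists_glue (fun F => (μ.restrict F)[g | m])
    (fun _ _ _ => stronglyMeasurable_condExp.measurable) (by
      intro F G hF hF' hG hG'
      rw [trim_measurableSet_eq hm ‹_›] at hF' hG'
      have h1 := condExp_restrict_ae_eq_of_subset hm (hF.inter hG) hF' Set.inter_subset_left
        (hgi F hF hF')
      have h2 := condExp_restrict_ae_eq_of_subset hm (hF.inter hG) hG' Set.inter_subset_right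
        (hgi G hG hG')
      have h3 := h1.symm.trans h2
      -- Both sides are `m`-measurable, so the equality passes to the trimmed measure.
      rw [← StronglyMeasurable.ae_eq_trim_iff hm stronglyMeasurable_condExp
        stronglyMeasurable_condExp, ← restrict_trim hm _ (hF.inter hG)] at h3
      filter_upwards [(ae_restrict_iff' (hF.inter hG)).1 h3] with x hx h4 h5 using hx ⟨h4, h5⟩)
  have hgF' : ∀ F, MeasurableSet[m] F → μ F < ∞ → (μ.restrict F)[g | m] =ᵐ[μ.restrict F] g' := by
    intro F hF hF'
    exact (ae_restrict_iff' (hm _ hF)).2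
      (ae_of_ae_trim hm (hgF F hF (by rwa [trim_measurableSet_eq hm hF])))
  have hs : StronglyMeasurable[m] g' := hg'.stronglyMeasurable
  refine ⟨g', hs, ?_, fun F hF hF' => ?_⟩
  · have hS : MeasurableSet[m] {x | ‖g' x‖ ≤ C}ᶜ :=
      (hs.norm.measurableSet_le stronglyMeasurable_const).compl
    have h0 := hν.1.measure_eq_zero hS fun F hFm hFfin => by
      rw [trim_measurableSet_eq hm hFm] at hFfin
      have : IsFiniteMeasure (μ.restrict F) := ⟨by simpa using hFfin⟩
      rw [trim_measurableSet_eq hm (hS.inter hFm), measure_eq_zero_iff_ae_notMem]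
      have h1 : ∀ᵐ a ∂μ.restrict F, ‖((μ.restrict F)[g | m]) a‖ ≤ C :=
        ae_bdd_norm_condExp_of_ae_bdd_norm (ae_restrict_of_ae hC)
      filter_upwards [(ae_restrict_iff' (hm _ hFm)).1 h1,
        (ae_restrict_iff' (hm _ hFm)).1 (hgF' F hFm hFfin)] with x h1 h2
      rintro ⟨h3, h4⟩
      exact h3 (by simp only [Set.mem_ofPred_eq]; rw [← h2 h4]; exact h1 h4)
    rw [trim_measurableSet_eq hm hS] at h0
    exact h0
  · have : IsFiniteMeasure (μ.restrict F) := ⟨by simpa using hF'⟩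
    rw [← integral_congr_ae (hgF' F hF hF'), integral_condExp hm]

/-- A strongly measurable representative has separable range, so all takes place in the closed span
of that range. -/
theorem exists_bounded_condExp (hm : m ≤ m0)
    (hν : IsMaharamMeasure (μ.trim hm)) {g : A → Y} (hg : AEStronglyMeasurable g μ) {C : ℝ}
    (hC : ∀ᵐ a ∂μ, ‖g a‖ ≤ C) :
    ∃ g' : A → Y, StronglyMeasurable[m] g' ∧ (∀ᵐ a ∂μ, ‖g' a‖ ≤ C) ∧
      ∀ F, MeasurableSet[m] F → μ F < ∞ → ∫ a in F, g a ∂μ = ∫ a in F, g' a ∂μ := by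
  borelize Y
  set u := hg.mk g with hu
  have hum : StronglyMeasurable u := hg.stronglyMeasurable_mk
  let V : Submodule ℝ Y := (Submodule.span ℝ (Set.range u)).topologicalClosure
  have hV : IsClosed (V : Set Y) := Submodule.isClosed_topologicalClosure _
  have : CompleteSpace V := hV.completeSpace_coe
  have hsep : TopologicalSpace.IsSeparable (V : Set Y) :=
    (hum.isSeparable_range.span (R := ℝ)).closure
  have : SecondCountableTopology V := by
    have := hsep.separableSpace
    exact UniformSpace.secondCountable_of_separable V
  have huV : ∀ a, u a ∈ V := fun a =>
    Submodule.le_topologicalClosure _ (Submodule.subset_span ⟨a, rfl⟩)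
  let v : A → V := fun a => ⟨u a, huV a⟩
  have hv : StronglyMeasurable v := (hum.measurable.subtype_mk).stronglyMeasurable
  obtain ⟨v', hv', hvC, hvF⟩ := exists_bounded_condExp_of_secondCountable hm hν
    hv.aestronglyMeasurable (C := C)
    (by filter_upwards [hC, hg.ae_eq_mk] with a h1 h2; rw [h2] at h1; exact h1)
  refine ⟨fun a => (v' a : Y), V.subtypeL.continuous.comp_stronglyMeasurable hv', hvC,
    fun F hF hF' => ?_⟩
  have h1 : Integrable v (μ.restrict F) := IntegrableOn.of_bound hF' hv.aestronglyMeasurable C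
    (ae_restrict_of_ae (by filter_upwards [hC, hg.ae_eq_mk] with a h1 h2; rw [h2] at h1; exact h1))
  have h2 : Integrable v' (μ.restrict F) :=
    IntegrableOn.of_bound hF' (hv'.mono hm).aestronglyMeasurable C (ae_restrict_of_ae hvC)
  have h3 := congrArg V.subtypeL (hvF F hF hF')
  rw [← ContinuousLinearMap.integral_comp_comm _ h1,
    ← ContinuousLinearMap.integral_comp_comm _ h2] at h3
  rw [integral_congr_ae (ae_restrict_of_ae hg.ae_eq_mk)]
  exact h3

end Vector

theorem exists_contraction_of_functional_relation {𝕜 V : Type*} [NontriviallyNormedField 𝕜]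
    [NormedAddCommGroup V] [NormedSpace 𝕜 V] (R : V → V → Prop)
    (hex : ∀ f, ∃ f', R f f' ∧ ‖f'‖ ≤ ‖f‖) (huniq : ∀ f a b, R f a → R f b → a = b)
    (hadd : ∀ f g f' g', R f f' → R g g' → R (f + g) (f' + g'))
    (hsmul : ∀ (c : 𝕜) f f', R f f' → R (c • f) (c • f')) :
    ∃ E : V →L[𝕜] V, (∀ f f', R f f' ↔ f' = E f) ∧ ‖E‖ ≤ 1 := by
  choose E hE hEn using hex
  let T : V →ₗ[𝕜] V :=
    { toFun := E
      map_add' := fun f g => huniq _ _ _ (hE _) (hadd _ _ _ _ (hE f) (hE g))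
      map_smul' := fun c f => huniq _ _ _ (hE _) (hsmul c _ _ (hE f)) }
  refine ⟨T.mkContinuous 1 fun f => (hEn f).trans_eq (one_mul _).symm, fun f f' => ⟨fun h => ?_, ?_⟩,
    LinearMap.mkContinuous_norm_le _ zero_le_one _⟩
  · exact huniq _ _ _ h (hE f)
  · rintro rfl
    exact hE f

/-! ### Orthogonality under the pairing -/

section Pairing

variable {𝕜 A X Y : Type*} [RCLike 𝕜] {m m0 : MeasurableSpace A} {μ : Measure A}
  [NormedAddCommGroup X] [NormedSpace 𝕜 X] [NormedAddCommGroup Y] [NormedSpace 𝕜 Y]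
  (B : X →L[𝕜] Y →L[𝕜] 𝕜)

theorem norm_pairing_le_of_bound {f : X} {g : Y} {C : ℝ} (hg : ‖g‖ ≤ C) :
    ‖B f g‖ ≤ ‖B‖ * C * ‖f‖ := by
  calc ‖B f g‖ ≤ ‖B‖ * ‖f‖ * ‖g‖ := B.le_opNorm₂ f g
    _ ≤ ‖B‖ * ‖f‖ * C := by gcongr
    _ = ‖B‖ * C * ‖f‖ := by ring

theorem integrable_pairing {f : A → X} {g : A → Y} (hf : Integrable f μ)
    (hg : AEStronglyMeasurable g μ) {C : ℝ} (hC : ∀ᵐ a ∂μ, ‖g a‖ ≤ C) :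
    Integrable (fun a => B (f a) (g a)) μ :=
  (hf.norm.const_mul (‖B‖ * C)).mono' (B.aestronglyMeasurable_comp₂ hf.1 hg)
    (hC.mono fun _ h => norm_pairing_le_of_bound B h)

/-- An integrable function whose integrals over the sets of `m` vanish is orthogonal to the bounded
`m`-measurable functions. -/
theorem integral_pairing_eq_zero_of_stronglyMeasurable_right [NormedSpace ℝ X]
    [NormedSpace ℝ Y] [CompleteSpace X] (hm : m ≤ m0)
    {d : A → X} (hd : Integrable d μ)
    (h0 : ∀ F, MeasurableSet[m] F → ∫ a in F, d a ∂μ = 0) {h : A → Y}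
    (hh : StronglyMeasurable[m] h) {C : ℝ} (hC : ∀ᵐ a ∂μ, ‖h a‖ ≤ C) :
    ∫ a, B (d a) (h a) ∂μ = 0 := by
  wlog hC0 : 0 ≤ C generalizing C
  · exact this (hC.mono fun a ha => ha.trans (le_max_left C 0)) (le_max_right C 0)
  -- Simple functions come first; bounded approximation and dominated convergence then give `h`.
  have hs : ∀ s : @SimpleFunc A m Y, Integrable (fun a => B (d a) (s a)) μ ∧
      ∫ a, B (d a) (s a) ∂μ = 0 := by
    intro s
    induction s using SimpleFunc.induction with
    | const c hS =>
      rename_i S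
      have heq : (fun a => B (d a) (@SimpleFunc.piecewise A Y m S hS (@SimpleFunc.const A Y m c)
          (@SimpleFunc.const A Y m 0) a)) = S.indicator fun a => B.flip c (d a) := by
        ext a
        by_cases ha : a ∈ S <;> simp [SimpleFunc.coe_piecewise, ha]
      simp only [heq]
      refine ⟨((B.flip c).integrable_comp hd).indicator (hm _ hS), ?_⟩
      rw [integral_indicator (hm _ hS),
        ContinuousLinearMap.integral_comp_comm _ hd.integrableOn, h0 _ hS, map_zero]
    | add _ h1 h2 =>
      simp only [SimpleFunc.coe_add, Pi.add_apply, map_add]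
      exact ⟨h1.1.add h2.1, by rw [integral_add h1.1 h2.1, h1.2, h2.2, add_zero]⟩
  refine tendsto_nhds_unique (tendsto_integral_of_dominated_convergence
    (F := fun n a => B (d a) (hh.approxBounded C n a)) (fun a => ‖B‖ * C * ‖d a‖)
    (fun n => (hs _).1.1) (hd.norm.const_mul _)
    (fun n => .of_forall fun a => norm_pairing_le_of_bound B (hh.norm_approxBounded_le hC0 n a))
    (hC.mono fun a ha => ((B (d a)).continuous.tendsto _).comp
      (hh.tendsto_approxBounded_of_norm_le ha))) ?_
  simp only [(hs _).2]
  exact tendsto_const_nhds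

/-- A bounded function whose integrals over the sets of finite measure of `m` vanish is orthogonal
to the integrable `m`-measurable functions. -/
theorem integral_pairing_eq_zero_of_aestronglyMeasurable_left [NormedSpace ℝ X]
    [NormedSpace ℝ Y] [CompleteSpace Y] (hm : m ≤ m0)
    {k : A → X} (hk : Integrable k μ) (hkm : AEStronglyMeasurable[m] k μ) {g : A → Y}
    (hg : AEStronglyMeasurable g μ) {C : ℝ} (hC : ∀ᵐ a ∂μ, ‖g a‖ ≤ C)
    (h0 : ∀ F, MeasurableSet[m] F → μ F < ∞ → ∫ a in F, g a ∂μ = 0) :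
    ∫ a, B (k a) (g a) ∂μ = 0 := by
  -- Continuity of this functional on `L¹` supplies the closedness step of the induction below.
  let T : Lp X 1 μ →ₗ[𝕜] 𝕜 :=
    { toFun := fun f => ∫ a, B (f a) (g a) ∂μ
      map_add' := fun f f' => by
        rw [← integral_add (integrable_pairing B (L1.integrable_coeFn f) hg hC)
          (integrable_pairing B (L1.integrable_coeFn f') hg hC)]
        refine integral_congr_ae ((Lp.coeFn_add f f').mono fun a ha => ?_)
        simp only [ha, Pi.add_apply, map_add, add_apply]
      map_smul' := fun c f => by
        rw [RingHom.id_apply, ← integral_smul]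
        refine integral_congr_ae ((Lp.coeFn_smul c f).mono fun a ha => ?_)
        simp only [ha, Pi.smul_apply, map_smul, smul_apply] }
  have hT : Continuous T := by
    refine (T.mkContinuous (‖B‖ * C) fun f => ?_).continuous
    rw [L1.norm_eq_integral_norm, ← integral_const_mul]
    exact norm_integral_le_of_norm_le ((L1.integrable_coeFn f).norm.const_mul _)
      (hC.mono fun a ha => norm_pairing_le_of_bound B ha)
  refine MemLp.induction_stronglyMeasurable hm ENNReal.one_ne_top
    (fun k => ∫ a, B (k a) (g a) ∂μ = 0) ?_ ?_ ?_ ?_ (memLp_one_iff_integrable.2 hk) hkm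
  · intro c F hF hF'
    have heq : (fun a => B (F.indicator (fun _ => c) a) (g a)) =
        F.indicator fun a => B c (g a) := by
      ext a
      by_cases ha : a ∈ F <;> simp [ha]
    have hgF : IntegrableOn g F μ := IntegrableOn.of_bound hF' hg.restrict C (ae_restrict_of_ae hC)
    simp only [heq]
    rw [integral_indicator (hm _ hF), ContinuousLinearMap.integral_comp_comm _ hgF, h0 F hF hF',
      map_zero]
  · intro f f' _ hf hf' _ _ h1 h2
    simp only [Pi.add_apply, map_add, add_apply]
    rw [integral_add (integrable_pairing B (memLp_one_iff_integrable.1 hf) hg hC)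
      (integrable_pairing B (memLp_one_iff_integrable.1 hf') hg hC), h1, h2, add_zero]
  · exact isClosed_eq (hT.comp continuous_subtype_val) continuous_const
  · intro f f' hff' _ h1
    rw [← h1]
    exact integral_congr_ae (hff'.mono fun a ha => by simp [ha])

end Pairing

/-! ### Existence on `L¹` -/

theorem IsCondExpL1.exists_sigmaFinite_support {𝕜 A X : Type*} [RCLike 𝕜]
    {m m0 : MeasurableSpace A} {μ : Measure A} [NormedAddCommGroup X] (hm : m ≤ m0) (f : Lp X 1 μ)
    {u φ : Lp 𝕜 1 μ} (hu : ∀ᵐ a ∂μ, u a = (‖f a‖ : ℝ)) (hφ : IsCondExpL1 m u φ) :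
    ∃ S : ℕ → Set A, (∀ n, MeasurableSet[m] (S n) ∧ μ (S n) < ∞) ∧
      ∀ᵐ a ∂μ, a ∉ (⋃ n, S n) → f a = 0 := by
  set ψ := hφ.1.mk φ
  have hψm : StronglyMeasurable[m] ψ := hφ.1.stronglyMeasurable_mk
  have hψ : φ =ᵐ[μ] ψ := hφ.1.ae_eq_mk
  have hψi : Integrable ψ μ := (L1.integrable_coeFn φ).congr hψ
  have hS : ∀ n : ℕ, MeasurableSet[m] {a | 1 / ((n : ℝ) + 1) ≤ ‖ψ a‖} := fun n =>
    stronglyMeasurable_const.measurableSet_le hψm.norm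
  refine ⟨fun n => {a | 1 / ((n : ℝ) + 1) ≤ ‖ψ a‖}, fun n => ⟨hS n,
    hψi.measure_norm_ge_lt_top (by positivity)⟩, ?_⟩
  set U := ⋃ n : ℕ, {a | 1 / ((n : ℝ) + 1) ≤ ‖ψ a‖}
  have hU : MeasurableSet[m] U := MeasurableSet.iUnion hS
  have hψ0 : ∀ a ∈ Uᶜ, ψ a = 0 := by
    intro a ha
    by_contra hne
    obtain ⟨n, hn⟩ := exists_nat_one_div_lt (norm_pos_iff.2 hne)
    exact ha (Set.mem_iUnion.2 ⟨n, hn.le⟩)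
  -- `Uᶜ` lies in `m` and `ψ` vanishes on it, so the integral of `‖f‖` over it is that of `ψ`.
  have hint : ∫ a in Uᶜ, ‖f a‖ ∂μ = 0 := by
    have h1 := hφ.2 _ hU.compl
    rw [integral_congr_ae (ae_restrict_of_ae hu), integral_congr_ae (ae_restrict_of_ae hψ),
      setIntegral_eq_zero_of_forall_eq_zero hψ0, integral_ofReal] at h1
    exact_mod_cast h1
  rw [setIntegral_eq_zero_iff_of_nonneg_ae (.of_forall fun _ => norm_nonneg _)
    (L1.integrable_coeFn f).norm.integrableOn] at hint
  filter_upwards [(ae_restrict_iff' (hm _ hU.compl)).1 hint] with a ha haU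
  exact norm_eq_zero.1 (ha haU)

section L1

variable {A X : Type*} {m m0 : MeasurableSpace A} {μ : Measure A}
  [NormedAddCommGroup X] [NormedSpace ℝ X] [CompleteSpace X]

theorem exists_isCondExpL1_of_sigmaFinite_support (hm : m ≤ m0) (f : Lp X 1 μ) (S : ℕ → Set A)
    (hS : ∀ n, MeasurableSet[m] (S n) ∧ μ (S n) < ∞)
    (hf : ∀ᵐ a ∂μ, a ∉ (⋃ n, S n) → f a = 0) :
    ∃ f' : Lp X 1 μ, IsCondExpL1 m f f' ∧ ‖f'‖ ≤ ‖f‖ := by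
  set U := ⋃ n, S n
  have hU : MeasurableSet[m] U := MeasurableSet.iUnion fun n => (hS n).1
  have hσ : SigmaFinite ((μ.restrict U).trim hm) := by
    -- Adding `Uᶜ`, null for `μ.restrict U`, makes the sets cover the whole space.
    refine ⟨⟨⟨fun n => S n ∪ Uᶜ, fun _ => trivial, fun n => ?_, ?_⟩⟩⟩
    · have hmeas := (hS n).1.union hU.compl
      rw [trim_measurableSet_eq hm hmeas, Measure.restrict_apply (hm _ hmeas)]
      refine (measure_mono ?_).trans_lt (hS n).2
      rintro a ⟨h | h, h'⟩
      exacts [h, absurd h' h]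
    · rw [← Set.iUnion_union, Set.union_compl_self]
  set h := (μ.restrict U)[f | m] with hh
  have hhi : Integrable h (μ.restrict U) := integrable_condExp
  have hmem : MemLp (U.indicator h) 1 μ :=
    (memLp_indicator_iff_restrict (hm _ hU)).2 (memLp_one_iff_integrable.2 hhi)
  refine ⟨hmem.toLp _, ⟨?_, fun F hF => ?_⟩, ?_⟩
  · exact ((stronglyMeasurable_condExp.indicator hU).aestronglyMeasurable).congr
      hmem.coeFn_toLp.symm
  · rw [integral_congr_ae (ae_restrict_of_ae hmem.coeFn_toLp), setIntegral_indicator (hm _ hU),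
      ← Measure.restrict_restrict (hm _ hF), hh, setIntegral_condExp hm
      (L1.integrable_coeFn f).restrict hF, Measure.restrict_restrict (hm _ hF)]
    refine setIntegral_eq_of_subset_of_ae_sdiff_eq_zero (hm _ hF).nullMeasurableSet
      Set.inter_subset_left (hf.mono fun a ha haF => ha fun haU => haF.2 ⟨haF.1, haU⟩)
  · rw [Lp.norm_toLp, Lp.norm_def]
    refine ENNReal.toReal_mono (Lp.eLpNorm_ne_top f) ?_
    rw [eLpNorm_indicator_eq_eLpNorm_restrict (hm _ hU)]
    exact (eLpNorm_condExp_le_eLpNorm _ le_rfl).trans (eLpNorm_mono_measure _ Measure.restrict_le_self)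

theorem exists_isCondExpL1_of_scalar {𝕜 : Type*} [RCLike 𝕜] (hm : m ≤ m0)
    (h : ∀ u : Lp 𝕜 1 μ, ∃ φ : Lp 𝕜 1 μ, IsCondExpL1 m u φ) (f : Lp X 1 μ) :
    ∃ f' : Lp X 1 μ, IsCondExpL1 m f f' ∧ ‖f'‖ ≤ ‖f‖ := by
  have hi : Integrable (fun a => ((‖f a‖ : ℝ) : 𝕜)) μ := (L1.integrable_coeFn f).norm.ofReal
  obtain ⟨φ, hφ⟩ := h (hi.toL1 _)
  obtain ⟨S, hS, hfS⟩ := hφ.exists_sigmaFinite_support hm f hi.coeFn_toL1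
  exact exists_isCondExpL1_of_sigmaFinite_support hm f S hS hfS

end L1

/-! ### The operators on `L^∞` and `L¹` -/

section Linfty

variable {A Y : Type*} {m m0 : MeasurableSpace A} {μ : Measure A} [NormedAddCommGroup Y]

theorem Lp_top_ae_norm_le (g : Lp Y ∞ μ) : ∀ᵐ a ∂μ, ‖g a‖ ≤ ‖g‖ := by
  filter_upwards [ae_le_eLpNormEssSup (f := g) (μ := μ)] with a ha
  rw [Lp.norm_def, eLpNorm_exponent_top, ← toReal_enorm]
  exact ENNReal.toReal_mono (by simpa using Lp.eLpNorm_ne_top g) ha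

theorem Lp_top_integrableOn (g : Lp Y ∞ μ) {F : Set A} (hF : μ F < ∞) : IntegrableOn g F μ :=
  IntegrableOn.of_bound hF (Lp.aestronglyMeasurable g).restrict _
    (ae_restrict_of_ae (Lp_top_ae_norm_le g))

theorem exists_isCondExpLinfty [NormedSpace ℝ Y] [CompleteSpace Y] (hm : m ≤ m0)
    (hν : IsMaharamMeasure (μ.trim hm)) (g : Lp Y ∞ μ) :
    ∃ g' : Lp Y ∞ μ, IsCondExpLinfty m g g' ∧ ‖g'‖ ≤ ‖g‖ := by
  obtain ⟨h, hh, hC, hF⟩ := exists_bounded_condExp hm hν (Lp.aestronglyMeasurable g)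
    (Lp_top_ae_norm_le g)
  have hmem : MemLp h ∞ μ := memLp_top_of_bound (hh.mono hm).aestronglyMeasurable _ hC
  refine ⟨hmem.toLp h, ⟨hh.aestronglyMeasurable.congr hmem.coeFn_toLp.symm, fun F hFm hFfin => ?_⟩,
    ?_⟩
  · rw [hF F hFm hFfin]
    exact (integral_congr_ae (ae_restrict_of_ae hmem.coeFn_toLp)).symm
  · rw [Lp.norm_toLp, eLpNorm_exponent_top]
    exact ENNReal.toReal_le_of_le_ofReal (norm_nonneg _) (eLpNormEssSup_le_of_ae_bound hC)

end Linfty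

section Algebra

variable {𝕜 A Z : Type*} [RCLike 𝕜] {m m0 : MeasurableSpace A} {μ : Measure A}
  [NormedAddCommGroup Z] [NormedSpace 𝕜 Z] [NormedSpace ℝ Z] [IsScalarTower ℝ 𝕜 Z]

theorem setIntegral_Lp_add {p : ℝ≥0∞} (f g : Lp Z p μ) {F : Set A}
    (hf : IntegrableOn f F μ) (hg : IntegrableOn g F μ) :
    ∫ a in F, (f + g : Lp Z p μ) a ∂μ = ∫ a in F, f a ∂μ + ∫ a in F, g a ∂μ := by
  rw [← integral_add hf hg]
  exact integral_congr_ae (ae_restrict_of_ae (Lp.coeFn_add f g))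

theorem setIntegral_Lp_smul {p : ℝ≥0∞} (c : 𝕜) (f : Lp Z p μ) (F : Set A) :
    ∫ a in F, (c • f : Lp Z p μ) a ∂μ = c • ∫ a in F, f a ∂μ := by
  have : SMulCommClass ℝ 𝕜 Z := IsScalarTower.to_smulCommClass
  rw [← integral_smul]
  exact integral_congr_ae (ae_restrict_of_ae (Lp.coeFn_smul c f))

theorem exists_condExpLinfty_clm [CompleteSpace Z] (hm : m ≤ m0)
    (hν : IsMaharamMeasure (μ.trim hm)) :
    ∃ E : Lp Z ∞ μ →L[𝕜] Lp Z ∞ μ,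
      (∀ g g' : Lp Z ∞ μ, IsCondExpLinfty m g g' ↔ g' = E g) ∧ ‖E‖ ≤ 1 := by
  refine exists_contraction_of_functional_relation _ (exists_isCondExpLinfty hm hν) ?_ ?_ ?_
  · intro g a b ha hb
    exact Lp.ext (hν.1.ae_eq_of_forall_setIntegral_eq hm ha.1 hb.1
      (fun _ _ h => Lp_top_integrableOn a h) (fun _ _ h => Lp_top_integrableOn b h)
      fun F hF hF' => (ha.2 F hF hF').symm.trans (hb.2 F hF hF'))
  · intro f g f' g' hf hg
    refine ⟨(hf.1.add hg.1).congr (Lp.coeFn_add f' g').symm, fun F hF hF' => ?_⟩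
    rw [setIntegral_Lp_add _ _ (Lp_top_integrableOn f hF') (Lp_top_integrableOn g hF'),
      setIntegral_Lp_add _ _ (Lp_top_integrableOn f' hF') (Lp_top_integrableOn g' hF'),
      hf.2 F hF hF', hg.2 F hF hF']
  · intro c f f' hf
    refine ⟨(hf.1.const_smul c).congr (Lp.coeFn_smul c f').symm, fun F hF hF' => ?_⟩
    rw [setIntegral_Lp_smul, setIntegral_Lp_smul, hf.2 F hF hF']

theorem exists_condExpL1_clm [CompleteSpace Z] (hm : m ≤ m0)
    (hν : IsSemifiniteMeasure (μ.trim hm))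
    (h : ∀ u : Lp 𝕜 1 μ, ∃ φ : Lp 𝕜 1 μ, IsCondExpL1 m u φ) :
    ∃ E : Lp Z 1 μ →L[𝕜] Lp Z 1 μ, (∀ f f' : Lp Z 1 μ, IsCondExpL1 m f f' ↔ f' = E f) ∧
      ‖E‖ ≤ 1 := by
  refine exists_contraction_of_functional_relation _ (exists_isCondExpL1_of_scalar hm h) ?_ ?_ ?_
  · intro g a b ha hb
    exact Lp.ext (hν.ae_eq_of_forall_setIntegral_eq hm ha.1 hb.1
      (fun _ _ _ => (L1.integrable_coeFn a).integrableOn)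
      (fun _ _ _ => (L1.integrable_coeFn b).integrableOn)
      fun F hF _ => (ha.2 F hF).symm.trans (hb.2 F hF))
  · intro f g f' g' hf hg
    refine ⟨(hf.1.add hg.1).congr (Lp.coeFn_add f' g').symm, fun F hF => ?_⟩
    rw [setIntegral_Lp_add _ _ (L1.integrable_coeFn f).integrableOn
      (L1.integrable_coeFn g).integrableOn, setIntegral_Lp_add _ _
      (L1.integrable_coeFn f').integrableOn (L1.integrable_coeFn g').integrableOn,
      hf.2 F hF, hg.2 F hF]
  · intro c f f' hf
    refine ⟨(hf.1.const_smul c).congr (Lp.coeFn_smul c f').symm, fun F hF => ?_⟩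
    rw [setIntegral_Lp_smul, setIntegral_Lp_smul, hf.2 F hF]

end Algebra

/-! ### Duality and the main theorem -/

/-- The conditional expectations on `L¹(A;X)` and `L^∞(A;Y)` are dual to each other. -/
theorem integral_pairing_condExp {𝕜 A X Y : Type*} [RCLike 𝕜] {m m0 : MeasurableSpace A}
    {μ : Measure A} [NormedAddCommGroup X] [NormedSpace 𝕜 X] [NormedSpace ℝ X] [CompleteSpace X]
    [NormedAddCommGroup Y] [NormedSpace 𝕜 Y] [NormedSpace ℝ Y] [CompleteSpace Y]
    (B : X →L[𝕜] Y →L[𝕜] 𝕜) (hm : m ≤ m0) {f f' : Lp X 1 μ} {g g' : Lp Y ∞ μ}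
    (hf : IsCondExpL1 m f f') (hg : IsCondExpLinfty m g g') :
    ∫ a, B (f a) (g' a) ∂μ = ∫ a, B (f' a) (g a) ∂μ := by
  have hfi := L1.integrable_coeFn f
  have hfi' := L1.integrable_coeFn f'
  have hgm := Lp.aestronglyMeasurable g
  have hgm' := Lp.aestronglyMeasurable g'
  have hgC := Lp_top_ae_norm_le g
  have hgC' := Lp_top_ae_norm_le g'
  -- `f - f'` is orthogonal to the bounded `m`-measurable `g'`, and `g - g'` to the integrable
  -- `m`-measurable `f'`.
  have h1 : ∫ a, B (f a - f' a) (hg.1.mk g' a) ∂μ = 0 :=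
    integral_pairing_eq_zero_of_stronglyMeasurable_right B hm (hfi.sub hfi')
      (fun F hF => by
        rw [integral_sub' hfi.integrableOn hfi'.integrableOn, hf.2 F hF, sub_self])
      hg.1.stronglyMeasurable_mk (C := ‖g'‖)
      (by filter_upwards [hgC', hg.1.ae_eq_mk] with a h1 h2; rwa [← h2])
  have h2 : ∫ a, B (f' a) (g a - g' a) ∂μ = 0 :=
    integral_pairing_eq_zero_of_aestronglyMeasurable_left B hm hfi' hf.1 (hgm.sub hgm')
      (C := ‖g‖ + ‖g'‖)
      (by filter_upwards [hgC, hgC'] with a h1 h2 using (norm_sub_le _ _).trans (add_le_add h1 h2))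
      (fun F hF hF' => by
        rw [integral_sub (Lp_top_integrableOn g hF') (Lp_top_integrableOn g' hF'), hg.2 F hF hF',
          sub_self])
  have h3 : ∫ a, B (f a) (g' a) ∂μ = ∫ a, B (f' a) (g' a) ∂μ := by
    rw [← sub_eq_zero, ← integral_sub (integrable_pairing B hfi hgm' hgC')
      (integrable_pairing B hfi' hgm' hgC'), ← h1]
    refine integral_congr_ae (hg.1.ae_eq_mk.mono fun a ha => ?_)
    simp [← ha]
  have h4 : ∫ a, B (f' a) (g a) ∂μ = ∫ a, B (f' a) (g' a) ∂μ := by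
    rw [← sub_eq_zero, ← integral_sub (integrable_pairing B hfi' hgm hgC)
      (integrable_pairing B hfi' hgm' hgC'), ← h2]
    simp
  rw [h3, h4]

theorem mainTheorem6 {𝕜 : Type*} [RCLike 𝕜] {A : Type*}
    {m m0 : MeasurableSpace A} (hm : m ≤ m0) (μ : @Measure A m0)
    (hμ : IsSemifiniteMeasure μ) (hμm : IsMaharamMeasure (μ.trim hm))
    (Y : Type*) [NormedAddCommGroup Y] [NormedSpace 𝕜 Y] [NormedSpace ℝ Y]
    [IsScalarTower ℝ 𝕜 Y] [CompleteSpace Y] :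
    ∃ E : Lp Y ∞ μ →L[𝕜] Lp Y ∞ μ,
      -- `E g` is the one and only conditional expectation of `g`
      (∀ g g' : Lp Y ∞ μ, IsCondExpLinfty m g g' ↔ g' = E g) ∧
      -- `E` is a contractive projection with range `L^∞(A,m;Y)`
      ‖E‖ ≤ 1 ∧ E.comp E = E ∧ Set.range E = (lpMeas Y 𝕜 m ∞ μ : Set (Lp Y ∞ μ)) ∧
      -- for every Banach dual pair, `E` is dual to the conditional expectation on `L¹(A;X)`
      ∀ (X : Type*) [NormedAddCommGroup X] [NormedSpace 𝕜 X] [NormedSpace ℝ X]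
        [IsScalarTower ℝ 𝕜 X] [CompleteSpace X] (B : X →L[𝕜] Y →L[𝕜] 𝕜), IsBanachDuality B →
        (∀ f f' : Lp X 1 μ, IsCondExpL1 m f f' → ∀ g : Lp Y ∞ μ,
          ∫ a, B (f a) (E g a) ∂μ = ∫ a, B (f' a) (g a) ∂μ) ∧
        -- existence of the conditional expectation of individual elements of `L¹(A;X)`
        (∀ (f : Lp X 1 μ) (S : ℕ → Set A), (∀ n, MeasurableSet[m] (S n) ∧ μ (S n) < ∞) →
          (∀ᵐ a ∂μ, a ∉ (⋃ n, S n) → f a = 0) → ∃ f' : Lp X 1 μ, IsCondExpL1 m f f') ∧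
        -- existence of the conditional expectation operator on `L¹(A;X)`, and the duality for it
        ((∀ f : Lp 𝕜 1 μ, ∃ f' : Lp 𝕜 1 μ, IsCondExpL1 m f f') →
          ∃ E₁ : Lp X 1 μ →L[𝕜] Lp X 1 μ,
            (∀ f f' : Lp X 1 μ, IsCondExpL1 m f f' ↔ f' = E₁ f) ∧
            ∀ (f : Lp X 1 μ) (g : Lp Y ∞ μ),
              ∫ a, B (f a) (E g a) ∂μ = ∫ a, B (E₁ f a) (g a) ∂μ) := by
  obtain ⟨E, hE, hE1⟩ := exists_condExpLinfty_clm (𝕜 := 𝕜) (Z := Y) hm hμm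
  -- An `m`-measurable class is its own conditional expectation; idempotence and the range both
  -- follow.
  have hself : ∀ g : Lp Y ∞ μ, AEStronglyMeasurable[m] g μ → E g = g := fun g hg =>
    ((hE g g).1 ⟨hg, fun _ _ _ => rfl⟩).symm
  have hmeas : ∀ g, AEStronglyMeasurable[m] (E g) μ := fun g => ((hE g _).2 rfl).1
  refine ⟨E, hE, hE1, ContinuousLinearMap.ext fun g => hself _ (hmeas g), ?_, ?_⟩
  · ext g
    rw [SetLike.mem_coe, mem_lpMeas_iff_aestronglyMeasurable]
    refine ⟨?_, fun hg => ⟨g, hself g hg⟩⟩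
    rintro ⟨g, rfl⟩
    exact hmeas g
  · intro X _ _ _ _ _ B _
    have hdual : ∀ f f' : Lp X 1 μ, IsCondExpL1 m f f' → ∀ g : Lp Y ∞ μ,
        ∫ a, B (f a) (E g a) ∂μ = ∫ a, B (f' a) (g a) ∂μ := fun f f' hf g =>
      integral_pairing_condExp B hm hf ((hE g _).2 rfl)
    refine ⟨hdual, fun f S hS hf => ?_, fun h => ?_⟩
    · obtain ⟨f', hf', -⟩ := exists_isCondExpL1_of_sigmaFinite_support hm f S hS hf
      exact ⟨f', hf'⟩
    · obtain ⟨E₁, hE₁, -⟩ := exists_condExpL1_clm (𝕜 := 𝕜) (Z := X) hm hμm.1 h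
      exact ⟨E₁, hE₁, fun f g => hdual f _ ((hE₁ f _).2 rfl) g⟩
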